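/- \textbf{Setting.} A (recursive) structural causal model $\mathcal M$ over a finite set $\mathbf V$ of endogenous variables, each $X\in\mathbf V$ with a finite domain containing at least two values, consists of finitely many exogenous variables $\mathbf U$ with finite domains, a probability distribution $P(\mathbf u)$ on the joint values of $\mathbf U$, and for each $X\in\mathbf V$ a set $U_X\subseteq\mathbf U$, a set $\mathrm{Pa}_X\subseteq\mathbf V$ and a function $f_X$ of the values of $U_X$ and $\mathrm{Pa}_X$, such that the directed graph with edges $Y\to X$ $(Y\in \mathrm{Pa}_X)$ is acyclic. It induces the causal diagram $\mathcal G$ that has these directed edges and a bidirected edge between distinct $X,Y$ exactly when $U_X\cap U_Y\neq\emptyset$. For an assignment $\mathbf x$ to a subset of $\mathbf V$, the submodel $\mathcal M_{\mathbf x}$ replaces the functions of the variables in that subset by the constants $\mathbf x$; $Y_{\mathbf x}(\mathbf u)$ is the solution for $Y$ in $\mathcal M_{\mathbf x}$ at $\mathbf u$. For a set $\mathbf W_*$ of counterfactual variables $W_{\mathbf t}$ and a vector $\mathbf w_*$ of one value for each of them, $P(\mathbf W_*=\mathbf w_*)$ is the sum of $P(\mathbf u)$ over all $\mathbf u$ with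 $W_{\mathbf t}(\mathbf u)=w$ for all $W_{\mathbf t}\in\mathbf W_*$; and $P_{\mathbf x}(\mathbf y)$ is the probability that $\mathbf Y=\mathbf y$ in $\mathcal M_{\mathbf x}$. Write $\mathbf V(\mathbf W_*)$ for the set of $W\in \mathbf V$ such that some $W_{\mathbf t}\in\mathbf W_*$. The expression $P(\mathbf W_*=\mathbf w_*)$ is a \emph{ctf-factor} in $\mathcal G$ if the subscript of each $W_{\mathbf t}\in\mathbf W_*$ is an assignment to exactly the parents of $W$ in $\mathcal G$. It \emph{has a conflict} if (i) some subscript $\mathbf t$ of a member of $\mathbf W_*$ gives to a variable $Z\in\mathbf V(\mathbf W_*)$ a value different from the value in $\mathbf w_*$ of some $Z_{\mathbf s}\in\mathbf W_*$, or (ii) two subscripts of members of $\mathbf W_*$ give different values to the same variable. It is \emph{inconsistent} if it is a ctf-factor, the induced subgraph $\mathcal G[\mathbf V(\mathbf W_*)]$ has exactly one c-component (it is nonempty and connected by bidirected edges), and it has a conflict. Let $\mathbb Z$ be any collection of subsets of $\mathbf V$. A query is \emph{identifiable from $\mathbb Z$} if any two models inducing $\mathcal G$ (with the given domains) which have the same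 distributions $P_{\mathbf z}(\mathbf V)$ for all $\mathbf Z\in\mathbb Z$ and all values $\mathbf z$ of $\mathbf Z$ give the query the same value. All statements below hold both when the models range over all models inducing $\mathcal G$ and when they range only over those with mutually independent exogenous variables. \textbf{Theorem (Ctf-factor identifiability).} Let $P(\mathbf W_*=\mathbf w_*)$ be a ctf-factor in $\mathcal G$, $\mathbf W=\mathbf V(\mathbf W_*)$ and $\mathbf W'=\mathbf V\setminus\mathbf W$. (1) If the factor has no conflict, then there are values $\mathbf w$ of $\mathbf W$ and $\mathbf w'$ of $\mathbf W'$ that are consistent with $\mathbf w_*$ and with all subscripts in $\mathbf W_*$, and for all such $\mathbf w,\mathbf w'$, in every model inducing $\mathcal G$, $$P(\mathbf W_*=\mathbf w_*)=P_{\mathbf w'}(\mathbf w).$$ (2) Suppose that $\mathcal G[\mathbf W]$ has exactly one c-component and that every variable of $\mathbf W$ that is a parent of another variable of $\mathbf W$ has at least three values. Then, for every $\mathbb Z$, the factor is identifiable from $\mathbb Z$ if and only if it is not inconsistent and, for some $\mathbf w,\mathbf w'$ consistent with $\mathbf w_*$ and with all subscripts in $\mathbf W_*$, the interventional probability $P_{\mathbf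 w'}(\mathbf w)$ is identifiable from $\mathbb Z$. In particular, if $\mathbf W'\in\mathbb Z$, then the factor is identifiable from $\mathbb Z$ if and only if it is not inconsistent. -/

import Mathlib

/-- A causal diagram on the vertex set `V`: directed edges, recorded by the parent sets `Pa`
(`j ∈ Pa i` means `j → i`), which have no directed cycle, and bidirected edges `bi`. -/
@[ext]
structure CausalDiagram (V : Type) where
  Pa : V → Set V
  bi : SimpleGraph V
  acyclic : ∀ i, ¬ Relation.TransGen (fun j k => j ∈ Pa k) i i

/-- A recursive structural causal model with endogenous variables `V`, the variable `i` having
domain `Val i`. `Exo` is the set of exogenous variables, all with finite domains, and `P` is the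
joint distribution of the exogenous variables. The mechanism `f i` takes the values of
the exogenous parents `UPa i` and of the endogenous parents `Pa i`. -/
structure SCM {V : Type} (Val : V → Type) where
  Exo : Type
  ExoVal : Exo → Type
  [exoFintype : Fintype Exo]
  [exoValFintype : ∀ e, Fintype (ExoVal e)]
  P : (∀ e, ExoVal e) → ℝ
  P_nonneg : ∀ u, 0 ≤ P u
  P_sum : ∑ᶠ u, P u = 1
  UPa : V → Set Exo
  Pa : V → Set V
  acyclic : ∀ i, ¬ Relation.TransGen (fun j k => j ∈ Pa k) i i
  f : ∀ i, (∀ e : UPa i, ExoVal e) → (∀ j : Pa i, Val j) → Val i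

attribute [instance] SCM.exoFintype SCM.exoValFintype

namespace SCM

variable {V : Type} {Val : V → Type}

/-- A unit of the population: a value of every exogenous variable. -/
abbrev Unit (M : SCM Val) : Type := ∀ e, M.ExoVal e

/-- The probability of an event: the sum of `P u` over the units `u` in it. The set of units is
finite. -/
noncomputable def prob (M : SCM Val) (E : Set M.Unit) : ℝ := ∑ᶠ u ∈ E, M.P u

/-- The causal diagram induced by a model. -/
def diagram (M : SCM Val) : CausalDiagram V where
  Pa := M.Pa
  bi :=
    { Adj := fun i j => i ≠ j ∧ (M.UPa i ∩ M.UPa j).Nonempty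
      symm := ⟨fun i j h => ⟨h.1.symm, by rw [Set.inter_comm]; exact h.2⟩⟩
      loopless := ⟨fun i h => h.1 rfl⟩ }
  acyclic := M.acyclic

/-- The exogenous variables are mutually independent. -/
def IndependentExogenous (M : SCM Val) : Prop :=
  ∃ p : ∀ e, M.ExoVal e → ℝ, (∀ e a, 0 ≤ p e a) ∧ (∀ e, ∑ a, p e a = 1) ∧
    ∀ u, M.P u = ∏ e, p e (u e)

theorem wellFounded_pa [Finite V] (M : SCM Val) : WellFounded (fun j k => j ∈ M.Pa k) := by
  have : Std.Irrefl (Relation.TransGen (fun j k => j ∈ M.Pa k)) := ⟨M.acyclic⟩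
  have h := Finite.wellFounded_of_trans_of_irrefl (Relation.TransGen (fun j k => j ∈ M.Pa k))
  exact Subrelation.wf (r := Relation.TransGen (fun j k => j ∈ M.Pa k))
    (fun {_ _} hjk => Relation.TransGen.single hjk) h

/-- The solution of the structural equations for the unit `u`. -/
noncomputable def solution [Finite V] (M : SCM Val) (u : M.Unit) : ∀ i, Val i :=
  M.wellFounded_pa.fix fun i rec => M.f i (fun e => u e) (fun j => rec j j.2)

theorem solution_eq [Finite V] (M : SCM Val) (u : M.Unit) (i : V) :
    M.solution u i = M.f i (fun e => u e) (fun j => M.solution u j) :=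
  M.wellFounded_pa.fix_eq _ i

/-- The structural equations have no other solution. -/
theorem eq_solution [Finite V] (M : SCM Val) (u : M.Unit) (v : ∀ i, Val i)
    (hv : ∀ i, v i = M.f i (fun e => u e) (fun j => v j)) : v = M.solution u := by
  funext i
  induction i using M.wellFounded_pa.induction with
  | _ i ih =>
    rw [hv i, M.solution_eq u i]
    congr 1
    funext j
    exact ih j j.2

end SCM

/-- An assignment of values to a subset of the variables; `none` means that the variable is not in
that subset. -/
abbrev PartialAssignment {V : Type} (Val : V → Type) : Type := ∀ i, Option (Val i)

/-- The subset of the variables to which a partial assignment gives a value. -/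
def PartialAssignment.dom {V : Type} {Val : V → Type} (x : PartialAssignment Val) : Set V :=
  {i | (x i).isSome}

open Classical in
/-- The restriction of a full assignment of values to the variables in `A`. -/
noncomputable def restrictTo {V : Type} {Val : V → Type} (v : ∀ i, Val i) (A : Set V) :
    PartialAssignment Val :=
  fun i => if i ∈ A then some (v i) else none

namespace SCM

variable {V : Type} {Val : V → Type}

/-- The submodel `M_x`: the mechanism of every variable in the domain of `x` is replaced by
the constant given by `x`. -/
def submodel (M : SCM Val) (x : PartialAssignment Val) : SCM Val :=
  { M with f := fun i a b => (x i).getD (M.f i a b) }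

/-- The potential response `i ↦ i_x(u)` of all variables to the intervention `x`. -/
noncomputable def response [Finite V] (M : SCM Val) (x : PartialAssignment Val) (u : M.Unit) :
    ∀ i, Val i :=
  (M.submodel x).solution u

/-- The interventional probability `P_x(a)` of the event that the variables in `A` take, in the
submodel `M_x`, the values that `v` gives them. -/
noncomputable def interventionalProb [Finite V] (M : SCM Val) (x : PartialAssignment Val)
    (A : Set V) (v : ∀ i, Val i) : ℝ :=
  M.prob {u | ∀ i ∈ A, M.response x u i = v i}

end SCM

/-- A counterfactual variable `Y_x`: the potential response of `var` to the intervention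
`sub`. -/
structure CtfVar {V : Type} (Val : V → Type) where
  var : V
  sub : PartialAssignment Val

variable {V : Type} {Val : V → Type}

/-- The probability `P(W_* = w_*)` of a counterfactual event, where `w_*` has one value for each
counterfactual variable in the set `W_*`. -/
noncomputable def SCM.ctfProb [Finite V] (M : SCM Val) (W : Set (CtfVar Val))
    (w : ∀ Y : W, Val Y.1.var) : ℝ :=
  M.prob {u | ∀ Y : W, M.response Y.1.sub u Y.1.var = w Y}

/-- `V(W_*)`: the variables that appear in `W_*`. -/
def observables (W : Set (CtfVar Val)) : Set V := {i | ∃ Y ∈ W, Y.var = i}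

/-- Every member of `W_*` has as its subscript an assignment to exactly its parents, so that
`P(W_* = w_*)` is a counterfactual factor. -/
def IsCtfFactor (G : CausalDiagram V) (W : Set (CtfVar Val)) : Prop :=
  ∀ Y ∈ W, Y.sub.dom = G.Pa Y.var

/-- The subgraph of `G` induced by `A` has exactly one c-component, that is, `A` is nonempty and
any two of its members are joined by a path of bidirected edges inside `A`. -/
def SingleCComponent (G : CausalDiagram V) (A : Set V) : Prop :=
  (G.bi.induce A).Connected

/-- Either a subscript conflicts with the value in `w_*` of the same variable, or two subscripts
give different values to the same variable. -/
def HasConflict (W : Set (CtfVar Val)) (w : ∀ Y : W, Val Y.1.var) : Prop :=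
  (∃ Y Z : W, ∃ z : Val Z.1.var, Y.1.sub Z.1.var = some z ∧ z ≠ w Z) ∨
  (∃ Y Y' : W, ∃ T : V, ∃ t t' : Val T,
    Y.1.sub T = some t ∧ Y'.1.sub T = some t' ∧ t ≠ t')

/-- `P(W_* = w_*)` is an inconsistent counterfactual factor. -/
def IsInconsistent (G : CausalDiagram V) (W : Set (CtfVar Val)) (w : ∀ Y : W, Val Y.1.var) :
    Prop :=
  IsCtfFactor G W ∧ SingleCComponent G (observables W) ∧ HasConflict W w

/-- The full assignment `v` is consistent with `w_*` and with every subscript in `W_*`. -/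
def AgreesWith (W : Set (CtfVar Val)) (w : ∀ Y : W, Val Y.1.var) (v : ∀ i, Val i) : Prop :=
  (∀ Y : W, v Y.1.var = w Y) ∧
  (∀ Y : W, ∀ T : V, ∀ t : Val T, Y.1.sub T = some t → v T = t)

/-- The causal models that induce `G`. -/
def inducingModels (Val : V → Type) (G : CausalDiagram V) : Set (SCM Val) :=
  {M | M.diagram = G}

/-- The causal models with mutually independent exogenous variables that induce `G`. -/
def independentInducingModels (Val : V → Type) (G : CausalDiagram V) : Set (SCM Val) :=
  {M | M.diagram = G ∧ M.IndependentExogenous}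

/-- `M` and `N` have the same distributions `P_z(V)`, for every `S ∈ Z` and all values
`z` of `S`. -/
def SameData [Finite V] (Z : Set (Set V)) (M N : SCM Val) : Prop :=
  ∀ S ∈ Z, ∀ z : PartialAssignment Val, z.dom = S → ∀ v : ∀ i, Val i,
    M.interventionalProb z Set.univ v = N.interventionalProb z Set.univ v

/-- The query `q` is identifiable from `Z` in the class `C` of models: in the models of the class,
it is a function of the distributions `P_z(V)`, for `S ∈ Z` and `z` a value of `S`. -/
def IdentifiableFrom [Finite V] (C : Set (SCM Val)) (Z : Set (Set V)) (q : SCM Val → ℝ) : Prop :=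
  ∀ M ∈ C, ∀ N ∈ C, SameData Z M N → q M = q N

/-! ### Structural equations and marginals -/

namespace SCM

/-! Without a conflict, all values and subscripts belong to one full assignment `v`. A variable
whose parents are all fixed by its subscript responds through its mechanism alone, so the factor and
`P_{w'}(w)` are the probability of the same event: `v` solves the equations of the variables in `W`
(`ctfProb_eq_interventionalProb`).

With a conflict, two models with independent fair bits on the bidirected edges agree on every
`P_z(V)` but not on the factor. A vertex takes the value `target`, chosen to realise `w_*`, if the
parity of its bits is `g` of its parents' values, and `alt` otherwise. For `g = 0` the zero unit
realises the factor. In the second model the factor forces a parity pattern that no unit has: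
usually odd at exactly one vertex of `W`, although each edge inside `W` contributes to two parities.

The distributions agree because `P_z(v)` only counts the units that solve the equations at a fixed
`v` (`response_eq_iff`), and a shift of the bits matches the two sets of units. As `W` is one
c-component, a path of edges can switch the parities at any two vertices. If two subscripts disagree
on `T`, `g` is odd at both of their variables when `T = t`, while the factor asks for oddness at one
only. If a subscript `X = t` contradicts the value of `X`, `g` is odd at the child only, and a third
value of `X` frees the parity at `X` in every observable situation with `X = t`. -/

theorem response_eq_iff [Finite V] (M : SCM Val) (x : PartialAssignment Val) (u : M.Unit)
    (v : ∀ i, Val i) :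
    (∀ i, M.response x u i = v i) ↔
      ∀ i, v i = (x i).getD (M.f i (fun e => u e) (fun j => v j)) := by
  constructor
  · intro h i
    obtain rfl : M.response x u = v := funext h
    exact (M.submodel x).solution_eq u i
  · intro h i
    exact (congrFun ((M.submodel x).eq_solution u v h) i).symm

/-- The potential response of a variable to an intervention on exactly its parents is given by its
mechanism. -/
theorem response_of_dom_eq_pa [Finite V] (M : SCM Val) (x : PartialAssignment Val) (u : M.Unit)
    (i : V) (pa : ∀ j : M.Pa i, Val j) (hi : x i = none) (hpa : ∀ j : M.Pa i, x j = some (pa j)) :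
    M.response x u i = M.f i (fun e => u e) pa := by
  have h := (M.response_eq_iff x u (M.response x u)).1 fun _ => rfl
  rw [h i, hi, Option.getD_none]
  congr 1
  funext j
  rw [h j, hpa j, Option.getD_some]

theorem prob_mem_eq_finsum_mem (M : SCM Val) (z : Set (∀ i, Val i)) (hz : z.Finite)
    (r : M.Unit → ∀ i, Val i) :
    M.prob {u | r u ∈ z} = ∑ᶠ v ∈ z, M.prob {u | r u = v} := by
  unfold prob
  rw [← finsum_mem_biUnion _ hz fun _ _ => Set.toFinite _]
  · congr 1
    funext u
    simp
  · intro a _ b _ hab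
    refine Set.disjoint_left.2 fun u ha hb => hab ?_
    exact ha.symm.trans hb

end SCM

theorem dom_restrictTo (v : ∀ i, Val i) (A : Set V) : (restrictTo v A).dom = A := by
  ext i
  by_cases h : i ∈ A <;> simp [PartialAssignment.dom, restrictTo, h]

/-- The data `P_z(V)` determine the marginals `P_z(A)`. -/
theorem SameData.interventionalProb_eq [Finite V] [∀ i, Finite (Val i)] {Z : Set (Set V)}
    {M N : SCM Val} (h : SameData Z M N) {z : PartialAssignment Val} (hz : z.dom ∈ Z) (A : Set V)
    (v : ∀ i, Val i) : M.interventionalProb z A v = N.interventionalProb z A v := by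
  have key : ∀ K : SCM Val, K.interventionalProb z A v =
      ∑ᶠ v' ∈ {v' : ∀ i, Val i | ∀ i ∈ A, v' i = v i}, K.interventionalProb z Set.univ v' := by
    intro K
    refine (K.prob_mem_eq_finsum_mem {v' : ∀ i, Val i | ∀ i ∈ A, v' i = v i}
      (Set.toFinite _) (K.response z)).trans ?_
    simp only [SCM.interventionalProb, funext_iff, Set.mem_univ, forall_const]
  rw [key M, key N]
  refine finsum_mem_congr rfl fun v' _ => h _ hz z rfl v'

/-! ### Counterfactual factors without conflict -/

section CtfFactor

variable {G : CausalDiagram V} {W : Set (CtfVar Val)} {w : ∀ Y : W, Val Y.1.var}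

theorem CausalDiagram.ne_of_mem_pa (G : CausalDiagram V) {i j : V} (h : j ∈ G.Pa i) : j ≠ i := by
  rintro rfl
  exact G.acyclic j (.single h)

theorem IsCtfFactor.sub_var_eq_none (hW : IsCtfFactor G W) (Y : W) : Y.1.sub Y.1.var = none := by
  by_contra h
  have : Y.1.var ∈ Y.1.sub.dom := Option.isSome_iff_ne_none.2 h
  rw [hW Y.1 Y.2] at this
  exact G.ne_of_mem_pa this rfl

theorem IsCtfFactor.mem_pa (hW : IsCtfFactor G W) (Y : W) {T : V} {t : Val T}
    (h : Y.1.sub T = some t) : T ∈ G.Pa Y.1.var := by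
  rw [← hW Y.1 Y.2]
  simp [PartialAssignment.dom, h]

theorem IsCtfFactor.exists_parents (hW : IsCtfFactor G W) (Y : W) :
    ∃ pa : ∀ j : G.Pa Y.1.var, Val j, ∀ j : G.Pa Y.1.var, Y.1.sub j = some (pa j) := by
  have : ∀ j : G.Pa Y.1.var, ∃ a, Y.1.sub j = some a := by
    intro j
    have hj : (j : V) ∈ Y.1.sub.dom := by rw [hW Y.1 Y.2]; exact j.2
    exact Option.isSome_iff_exists.1 hj
  exact ⟨fun j => (this j).choose, fun j => (this j).choose_spec⟩

/-- Two members of a counterfactual factor with the same variable, whose subscripts agree on its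
parents, are equal. -/
theorem IsCtfFactor.eq_of_var_eq (hW : IsCtfFactor G W) (Y Y' : W) (hv : Y.1.var = Y'.1.var)
    (hs : ∀ j ∈ G.Pa Y.1.var, Y.1.sub j = Y'.1.sub j) : Y = Y' := by
  have h1 := hW Y.1 Y.2
  have h2 := hW Y'.1 Y'.2
  obtain ⟨⟨x, s⟩, hY⟩ := Y
  obtain ⟨⟨x', s'⟩, hY'⟩ := Y'
  obtain rfl : x = x' := hv
  obtain rfl : s = s' := by
    funext j
    by_cases hj : j ∈ G.Pa x
    · exact hs j hj
    · have e1 : j ∉ s.dom := by rw [h1]; exact hj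
      have e2 : j ∉ s'.dom := by rw [h2]; exact hj
      simp only [PartialAssignment.dom, Set.mem_ofPred_eq, Bool.not_eq_true,
        Option.isSome_eq_false_iff, Option.isNone_iff_eq_none] at e1 e2
      rw [e1, e2]
  rfl

/-- The only point is that a variable of `W` is given a single value: two members with the same
variable have equal subscripts when no subscripts disagree, so they coincide. -/
theorem exists_agreesWith [∀ i, Nonempty (Val i)] (hW : IsCtfFactor G W)
    (hc : ¬ HasConflict W w) : ∃ v, AgreesWith W w v := by
  simp only [HasConflict, not_or, not_exists, not_and, not_not] at hc
  obtain ⟨hc1, hc2⟩ := hc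
  have : ∀ i : V, ∃ a : Val i, (∀ Y : W, ∀ h : Y.1.var = i, a = h ▸ w Y) ∧
      ∀ Y : W, ∀ t : Val i, Y.1.sub i = some t → a = t := by
    intro i
    by_cases h1 : ∃ Y : W, Y.1.var = i
    · obtain ⟨Y, rfl⟩ := h1
      refine ⟨w Y, fun Y' h => ?_, fun Y' t h => (hc1 Y' Y t h).symm⟩
      obtain rfl : Y' = Y := by
        refine hW.eq_of_var_eq Y' Y h fun j hj => ?_
        obtain ⟨pa, hpa⟩ := hW.exists_parents Y
        obtain ⟨pa', hpa'⟩ := hW.exists_parents Y'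
        rw [hpa ⟨j, h ▸ hj⟩, hpa' ⟨j, hj⟩,
          hc2 Y Y' j _ _ (hpa ⟨j, h ▸ hj⟩) (hpa' ⟨j, hj⟩)]
      rfl
    · by_cases h2 : ∃ Y : W, ∃ t : Val i, Y.1.sub i = some t
      · obtain ⟨Y, t, ht⟩ := h2
        exact ⟨t, fun Y' h => (h1 ⟨Y', h⟩).elim, fun Y' t' h => hc2 Y Y' i t t' ht h⟩
      · exact ⟨Classical.arbitrary _, fun Y' h => (h1 ⟨Y', h⟩).elim,
          fun Y' t' h => (h2 ⟨Y', t', h⟩).elim⟩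
  choose v hv using this
  exact ⟨v, fun Y => (hv _).1 Y rfl, fun Y T => (hv T).2 Y⟩

/-- A counterfactual factor whose values and subscripts agree is an interventional probability. -/
theorem ctfProb_eq_interventionalProb [Finite V] (hW : IsCtfFactor G W) {v : ∀ i, Val i}
    (hv : AgreesWith W w v) (M : SCM Val) (hM : M.diagram = G) :
    M.ctfProb W w = M.interventionalProb (restrictTo v (observables W)ᶜ) (observables W) v := by
  subst hM
  unfold SCM.ctfProb SCM.interventionalProb
  congr 1
  ext u
  have hresp : ∀ Y : W, M.response Y.1.sub u Y.1.var =
      M.f Y.1.var (fun e => u e) (fun j => v j) := by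
    intro Y
    obtain ⟨pa, hpa⟩ := hW.exists_parents Y
    rw [M.response_of_dom_eq_pa Y.1.sub u Y.1.var pa (hW.sub_var_eq_none Y) hpa]
    congr 1
    funext j
    exact (hv.2 Y j _ (hpa j)).symm
  simp only [Set.mem_ofPred_eq]
  constructor
  · intro h i _
    -- Solutions are unique, so it is enough that `v` itself solves the submodel; outside `W` its
    -- equations are the constants of `v`.
    refine (M.response_eq_iff _ u v).2 (fun i => ?_) i
    by_cases hi : i ∈ observables W
    · obtain ⟨Y, hY, rfl⟩ := hi
      have hi : Y.var ∈ observables W := ⟨Y, hY, rfl⟩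
      simp only [restrictTo, Set.mem_compl_iff, hi, not_true_eq_false, if_false,
        Option.getD_none]
      rw [hv.1 ⟨Y, hY⟩, ← h ⟨Y, hY⟩, hresp ⟨Y, hY⟩]
    · simp [restrictTo, hi]
  · intro h Y
    have hall : ∀ i, M.response (restrictTo v (observables W)ᶜ) u i = v i := by
      intro i
      by_cases hi : i ∈ observables W
      · exact h i hi
      · have := (M.response_eq_iff (restrictTo v (observables W)ᶜ) u _).1 (fun _ => rfl) i
        rw [this]
        simp [restrictTo, hi]
    have hi : Y.1.var ∈ observables W := ⟨Y.1, Y.2, rfl⟩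
    have := (M.response_eq_iff _ u v).1 hall Y.1.var
    simp only [restrictTo, Set.mem_compl_iff, hi, not_true_eq_false, if_false,
        Option.getD_none] at this
    rw [hresp, ← this, hv.1]

/-- There are responses to the parents that take the values `w_*` at the subscripts in `W_*`. -/
theorem IsCtfFactor.exists_target [∀ i, Nonempty (Val i)] (hW : IsCtfFactor G W)
    (w : ∀ Y : W, Val Y.1.var) :
    ∃ target : ∀ x, (∀ j : G.Pa x, Val j) → Val x, ∀ Y : W, ∀ pa : ∀ j : G.Pa Y.1.var, Val j,
      (∀ j : G.Pa Y.1.var, Y.1.sub j = some (pa j)) → target Y.1.var pa = w Y := by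
  have : ∀ x, ∀ pa : ∀ j : G.Pa x, Val j, ∃ a : Val x, ∀ Y : W, ∀ h : Y.1.var = x,
      (∀ j : G.Pa x, Y.1.sub j = some (pa j)) → a = h ▸ w Y := by
    intro x pa
    by_cases h1 : ∃ Y : W, Y.1.var = x ∧ ∀ j : G.Pa x, Y.1.sub j = some (pa j)
    · obtain ⟨Y, rfl, hY⟩ := h1
      refine ⟨w Y, fun Y' h hY' => ?_⟩
      obtain rfl : Y' = Y := hW.eq_of_var_eq Y' Y h fun j hj => by
        rw [hY ⟨j, h ▸ hj⟩, hY' ⟨j, h ▸ hj⟩]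
      rfl
    · exact ⟨Classical.arbitrary _, fun Y h hY => (h1 ⟨Y, h, hY⟩).elim⟩
  choose target ht using this
  exact ⟨target, fun Y pa h => ht _ pa Y rfl h⟩

end CtfFactor

/-! ### Parity models and the criterion for non-identifiability -/

section ParityModel

/-- The exogenous variables of a vertex `x` in the parity models: one for every bidirected edge
at `x`, and a private one, indexed by the diagonal element `s(x, x)`. -/
def CausalDiagram.exoParents (G : CausalDiagram V) (x : V) : Set (Sym2 V) :=
  {e | x ∈ e ∧ (e ∈ G.bi.edgeSet ∨ e.IsDiag)}

open Classical in
/-- The parity at the vertex `x` of the bits on the members of `S` that contain `x`. -/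
noncomputable def parityAt (S : Set (Sym2 V)) (x : V) (u : Sym2 V → ZMod 2) : ZMod 2 :=
  ∑ᶠ e, if x ∈ e ∧ e ∈ S then u e else 0

theorem parityAt_add [Finite V] (S : Set (Sym2 V)) (x : V) (u u' : Sym2 V → ZMod 2) :
    parityAt S x (u + u') = parityAt S x u + parityAt S x u' := by
  unfold parityAt
  rw [← finsum_add_distrib (Set.toFinite _) (Set.toFinite _)]
  refine finsum_congr fun e => ?_
  split_ifs <;> simp

theorem parityAt_zero (S : Set (Sym2 V)) (x : V) : parityAt S x 0 = 0 := by
  simp [parityAt]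

open Classical in
theorem parityAt_single (S : Set (Sym2 V)) (x : V) (e : Sym2 V) :
    parityAt S x (Pi.single e 1) = if x ∈ e ∧ e ∈ S then 1 else 0 := by
  unfold parityAt
  rw [finsum_eq_single _ e]
  · simp
  · intro e' he'
    simp [he']

open Classical in
theorem ite_mem_sym2_of_ne {a b : V} (hab : a ≠ b) (x : V) :
    (if x ∈ s(a, b) then 1 else 0 : ZMod 2) =
      (if x = a then 1 else 0) + (if x = b then 1 else 0) := by
  by_cases h1 : x = a
  · subst h1
    simp [hab]
  · simp [h1]

/-- The bidirected edges inside `A`. -/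
def CausalDiagram.edgesWithin (G : CausalDiagram V) (A : Set V) : Set (Sym2 V) :=
  {e | e ∈ G.bi.edgeSet ∧ ∀ x ∈ e, x ∈ A}

theorem CausalDiagram.edgesWithin_subset (G : CausalDiagram V) (A : Set V) :
    G.edgesWithin A ⊆ {e | e ∈ G.bi.edgeSet ∨ e.IsDiag} :=
  fun _ he => .inl he.1

open Classical in
/-- Switching the bits along a path changes the parities at its two ends only. -/
theorem SingleCComponent.exists_parityAt [Finite V] {G : CausalDiagram V} {A : Set V}
    (h : SingleCComponent G A) {i j : V} (hi : i ∈ A) (hj : j ∈ A) :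
    ∃ χ : Sym2 V → ZMod 2, ∀ x, parityAt (G.edgesWithin A) x χ =
      (if x = i then 1 else 0) + (if x = j then 1 else 0) := by
  obtain ⟨p⟩ := h.preconnected ⟨i, hi⟩ ⟨j, hj⟩
  suffices ∀ a b : A, (G.bi.induce A).Walk a b → ∃ χ : Sym2 V → ZMod 2,
      ∀ x, parityAt (G.edgesWithin A) x χ =
        (if x = a then 1 else 0) + (if x = b then 1 else 0) from this _ _ p
  intro a b p
  induction p with
  | nil => exact ⟨0, fun x => by rw [parityAt_zero, CharTwo.add_self_eq_zero]⟩
  | @cons a c b hac p ih =>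
    obtain ⟨χ, hχ⟩ := ih
    have hadj : G.bi.Adj a c := hac
    have hmem : s((a : V), (c : V)) ∈ G.edgesWithin A := by
      refine ⟨hadj, fun x hx => ?_⟩
      rcases Sym2.mem_iff.1 hx with rfl | rfl
      · exact a.2
      · exact c.2
    refine ⟨χ + Pi.single s((a : V), (c : V)) 1, fun x => ?_⟩
    rw [parityAt_add, hχ, parityAt_single]
    simp only [hmem, and_true]
    rw [ite_mem_sym2_of_ne hadj.ne]
    linear_combination CharTwo.add_self_eq_zero (if x = (c : V) then 1 else 0 : ZMod 2)

/-- Every edge inside `A` has two distinct ends, both in `A`, so its bit is counted twice and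
vanishes modulo 2. -/
theorem finsum_mem_parityAt_edgesWithin [Finite V] (G : CausalDiagram V) (A : Set V)
    (u : Sym2 V → ZMod 2) : ∑ᶠ x ∈ A, parityAt (G.edgesWithin A) x u = 0 := by
  classical
  have : ∑ᶠ x ∈ A, parityAt (G.edgesWithin A) x u =
      -- A vertex outside `A` meets no edge inside `A`, so the sum may run over all vertices and be
      -- exchanged with the sum over edges.
      ∑ᶠ x, parityAt (G.edgesWithin A) x u := by
    refine finsum_congr fun x => ?_
    by_cases hx : x ∈ A
    · simp [hx]
    · have h0 : parityAt (G.edgesWithin A) x u = 0 := by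
        unfold parityAt
        refine finsum_eq_zero_of_forall_eq_zero fun e => if_neg ?_
        exact fun he => hx (he.2.2 x he.1)
      simp [hx, h0]
  rw [this]
  unfold parityAt
  let _ := Fintype.ofFinite V
  let _ := Fintype.ofFinite (Sym2 V)
  simp only [finsum_eq_sum_of_fintype]
  rw [Finset.sum_comm]
  refine Finset.sum_eq_zero fun e _ => ?_
  by_cases he : e ∈ G.edgesWithin A
  · induction e using Sym2.ind with
    | _ a b =>
      have hab : a ≠ b := G.bi.ne_of_adj he.1
      have : ∀ x, (if x ∈ s(a, b) ∧ s(a, b) ∈ G.edgesWithin A then u s(a, b) else 0) =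
          (if x = a then u s(a, b) else 0) + (if x = b then u s(a, b) else 0) := by
        intro x
        have := ite_mem_sym2_of_ne hab x
        by_cases h1 : x = a
        · subst h1
          simp [hab, he]
        · simp [h1, he]
      rw [Finset.sum_congr rfl fun x _ => this x, Finset.sum_add_distrib,
        Finset.sum_ite_eq', Finset.sum_ite_eq', if_pos (Finset.mem_univ a),
        if_pos (Finset.mem_univ b), CharTwo.add_self_eq_zero]
  · simp [he]

open Classical in
/-- The model with independent fair bits on the bidirected edges of `G` and at its vertices, in
which a vertex `x` with parents `pa` takes the value `target x pa` if its parity is `g x pa`, and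
otherwise the value `alt x pa`. -/
noncomputable def parityModel [Finite V] (G : CausalDiagram V) (S : Set (Sym2 V))
    (target alt : ∀ x, (∀ j : G.Pa x, Val j) → Val x)
    (g : ∀ x, (∀ j : G.Pa x, Val j) → ZMod 2) : SCM Val where
  Exo := Sym2 V
  ExoVal := fun _ => ZMod 2
  exoFintype := Fintype.ofFinite _
  exoValFintype := fun _ => inferInstance
  P := fun _ => (1 / 2) ^ Nat.card (Sym2 V)
  P_nonneg := fun _ => by positivity
  P_sum := by
    let _ := Fintype.ofFinite (Sym2 V)
    rw [finsum_eq_sum_of_fintype]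
    simp
  UPa := G.exoParents
  Pa := G.Pa
  acyclic := G.acyclic
  f := fun x ua pa =>
    if parityAt S x (fun e => if h : e ∈ G.exoParents x then ua ⟨e, h⟩ else 0) = g x pa
      then target x pa else alt x pa

variable [Finite V] (G : CausalDiagram V) {S : Set (Sym2 V)}
  (target alt : ∀ x, (∀ j : G.Pa x, Val j) → Val x)
  (g : ∀ x, (∀ j : G.Pa x, Val j) → ZMod 2)

-- The bits that `x` does not see are filled with 0 in the mechanism. This is harmless: each bit
-- that `parityAt S x` reads belongs to an exogenous parent of `x`.
open Classical in
theorem parityModel_f (hS : S ⊆ {e | e ∈ G.bi.edgeSet ∨ e.IsDiag}) (x : V)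
    (u : Sym2 V → ZMod 2) (pa : ∀ j : G.Pa x, Val j) :
    (parityModel G S target alt g).f x (fun e => u e.1) pa =
      if parityAt S x u = g x pa then target x pa else alt x pa := by
  have : parityAt S x (fun e => if e ∈ G.exoParents x then u e else 0) = parityAt S x u := by
    refine finsum_congr fun e => ?_
    by_cases h : x ∈ e ∧ e ∈ S
    · have : e ∈ G.exoParents x := ⟨h.1, hS h.2⟩
      simp [h, this]
    · simp [h]
  rw [← this]
  simp [parityModel]

/-- Distinct `i` and `j` can share only the bit on `s(i, j)`, which is present exactly for a
bidirected edge. Exogenous parents do not depend on `S`, so even bits that no mechanism reads keep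
the diagram equal to `G`. -/
theorem parityModel_diagram (S : Set (Sym2 V)) :
    (parityModel G S target alt g).diagram = G := by
  refine CausalDiagram.ext rfl ?_
  ext i j
  change i ≠ j ∧ (G.exoParents i ∩ G.exoParents j).Nonempty ↔ _
  constructor
  · rintro ⟨hij, e, ⟨hi, h⟩, hj, -⟩
    obtain rfl := (Sym2.mem_and_mem_iff hij).1 ⟨hi, hj⟩
    exact h.resolve_right fun h => hij h
  · intro h
    exact ⟨h.ne, s(i, j), ⟨Sym2.mem_mk_left i j, .inl h⟩, ⟨Sym2.mem_mk_right i j, .inl h⟩⟩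

theorem parityModel_independentExogenous (S : Set (Sym2 V)) :
    (parityModel G S target alt g).IndependentExogenous := by
  refine ⟨fun _ _ => 1 / 2, fun _ _ => by norm_num, fun e => ?_, fun u => ?_⟩
  · change ∑ a : ZMod 2, (1 / 2 : ℝ) = 1
    simp
  · let _ := Fintype.ofFinite (Sym2 V)
    change (1 / 2 : ℝ) ^ Nat.card (Sym2 V) = ∏ e : Sym2 V, (1 / 2 : ℝ)
    simp

theorem parityModel_mem_independentInducingModels (S : Set (Sym2 V)) :
    parityModel G S target alt g ∈ independentInducingModels Val G :=
  ⟨parityModel_diagram .., parityModel_independentExogenous ..⟩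

open Classical in
/-- Two parity models have the same interventional distributions if for every assignment a
switch of bits turns the equations of one into those of the other. -/
theorem sameData_parityModel (hS : S ⊆ {e | e ∈ G.bi.edgeSet ∨ e.IsDiag})
    (h : ∀ (z : PartialAssignment Val) (v : ∀ i, Val i), ∃ χ, ∀ u,
      (∀ i, v i = (z i).getD (if parityAt S i u = 0 then target i (fun j => v j)
          else alt i (fun j => v j))) ↔
      (∀ i, v i = (z i).getD (if parityAt S i (u + χ) = g i (fun j => v j)
          then target i (fun j => v j) else alt i (fun j => v j))))
    (Z : Set (Set V)) :
    SameData Z (parityModel G S target alt fun _ _ => 0) (parityModel G S target alt g) := by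
  intro _ _ z _ v
  obtain ⟨χ, hχ⟩ := h z v
  unfold SCM.interventionalProb SCM.prob
  -- The distribution of the bits is uniform, so translation by `χ` preserves it.
  refine finsum_mem_eq_of_bijOn (fun u : Sym2 V → ZMod 2 => u + χ) ?_ fun _ _ => rfl
  have hiff : ∀ u : Sym2 V → ZMod 2,
      (∀ i ∈ Set.univ, (parityModel G S target alt fun _ _ => 0).response z u i = v i) ↔
        ∀ i ∈ Set.univ, (parityModel G S target alt g).response z (u + χ) i = v i := by
    intro u
    simp only [Set.mem_univ, forall_const]
    refine (SCM.response_eq_iff (parityModel G S target alt fun _ _ => 0) z u v).trans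
      (Iff.trans ?_ ((hχ u).trans (Iff.trans ?_
        (SCM.response_eq_iff (parityModel G S target alt g) z (u + χ) v).symm)))
    · refine forall_congr' fun i => ?_
      rw [← parityModel_f G target alt (fun _ _ => 0) hS]
      rfl
    · refine forall_congr' fun i => ?_
      rw [← parityModel_f G target alt g hS]
      rfl
  refine ⟨fun u hu => (hiff u).1 hu, (add_left_injective χ).injOn,
    fun (u : Sym2 V → ZMod 2) hu => ?_⟩
  refine ⟨u - χ, (hiff _).2 ?_, sub_add_cancel u χ⟩
  rw [sub_add_cancel]
  exact hu

open Classical in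
/-- A counterfactual factor is not identifiable if it is possible in one of two parity models with
the same interventional distributions, but impossible in the other. -/
theorem not_identifiableFrom_of_parityModel {W : Set (CtfVar Val)} {w : ∀ Y : W, Val Y.1.var}
    (hW : IsCtfFactor G W)
    (htarget : ∀ Y : W, ∀ pa : ∀ j : G.Pa Y.1.var, Val j,
      (∀ j : G.Pa Y.1.var, Y.1.sub j = some (pa j)) → target Y.1.var pa = w Y)
    (hS : S ⊆ {e | e ∈ G.bi.edgeSet ∨ e.IsDiag})
    (h : ∀ (z : PartialAssignment Val) (v : ∀ i, Val i), ∃ χ, ∀ u,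
      (∀ i, v i = (z i).getD (if parityAt S i u = 0 then target i (fun j => v j)
          else alt i (fun j => v j))) ↔
      (∀ i, v i = (z i).getD (if parityAt S i (u + χ) = g i (fun j => v j)
          then target i (fun j => v j) else alt i (fun j => v j))))
    -- Where `alt` equals `target` the parity has no effect, so only the other members of the factor
    -- constrain it.
    (himp : ∀ u : Sym2 V → ZMod 2, ¬ ∀ Y : W, ∀ pa : ∀ j : G.Pa Y.1.var, Val j,
      (∀ j : G.Pa Y.1.var, Y.1.sub j = some (pa j)) →
        alt Y.1.var pa ≠ target Y.1.var pa → parityAt S Y.1.var u = g Y.1.var pa)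
    {C : Set (SCM Val)} (hC : independentInducingModels Val G ⊆ C) (Z : Set (Set V)) :
    ¬ IdentifiableFrom C Z fun M => M.ctfProb W w := by
  intro hid
  have heq := hid _ (hC (parityModel_mem_independentInducingModels G target alt _ S)) _
    (hC (parityModel_mem_independentInducingModels G target alt _ S))
    (sameData_parityModel G target alt g hS h Z)
  have hresp : ∀ (g : ∀ x, (∀ j : G.Pa x, Val j) → ZMod 2) (u : Sym2 V → ZMod 2) (Y : W)
      (pa : ∀ j : G.Pa Y.1.var, Val j), (∀ j : G.Pa Y.1.var, Y.1.sub j = some (pa j)) →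
      (parityModel G S target alt g).response Y.1.sub u Y.1.var =
        if parityAt S Y.1.var u = g Y.1.var pa then target Y.1.var pa
          else alt Y.1.var pa := by
    intro g u Y pa hpa
    rw [← parityModel_f G target alt g hS]
    exact (parityModel G S target alt g).response_of_dom_eq_pa Y.1.sub u Y.1.var pa
      (hW.sub_var_eq_none Y) hpa
  have hzero : (parityModel G S target alt g).ctfProb W w = 0 := by
    unfold SCM.ctfProb SCM.prob
    convert finsum_mem_empty
    refine Set.eq_empty_iff_forall_notMem.2 fun u hu => himp u fun Y pa hpa hne => ?_
    by_contra hpar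
    have := hu Y
    rw [hresp g u Y pa hpa, if_neg hpar, ← htarget Y pa hpa] at this
    exact hne this
  have hpos : 0 < (parityModel G S target alt fun _ _ => 0).ctfProb W w := by
    unfold SCM.ctfProb SCM.prob
    rw [finsum_mem_eq_finite_toFinset_sum _ (Set.toFinite _)]
    -- At the zero unit all parities are 0, and every member takes its target value.
    refine Finset.sum_pos (fun u _ => ?_) ⟨(0 : Sym2 V → ZMod 2), ?_⟩
    · change (0 : ℝ) < (1 / 2) ^ Nat.card (Sym2 V)
      positivity
    · refine (Set.Finite.mem_toFinset _).2 fun Y => ?_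
      obtain ⟨pa, hpa⟩ := hW.exists_parents Y
      exact (hresp _ 0 Y pa hpa).trans ((if_pos (parityAt_zero S _)).trans (htarget Y pa hpa))
  exact hpos.ne' (heq.trans hzero)

end ParityModel

/-! ### The two kinds of conflict -/

section Conflict

variable [Finite V] {G : CausalDiagram V} {W : Set (CtfVar Val)} {w : ∀ Y : W, Val Y.1.var}

open Classical in
/-- The parities of the bits on the edges inside `A` cannot be odd at exactly one vertex. -/
theorem parityAt_edgesWithin_ne_single (G : CausalDiagram V) {A : Set V} {i : V} (hi : i ∈ A)
    (u : Sym2 V → ZMod 2) :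
    ¬ ∀ x ∈ A, parityAt (G.edgesWithin A) x u = if x = i then 1 else 0 := by
  intro h
  have h0 := finsum_mem_parityAt_edgesWithin G A u
  rw [finsum_mem_congr rfl h, finsum_eq_single _ i fun x hx => by simp [hx]] at h0
  simp [hi] at h0

/-- A counterfactual factor in which two subscripts give different values to the same variable is
not identifiable. -/
theorem IsCtfFactor.not_identifiableFrom_of_sub_ne [∀ i, Nontrivial (Val i)]
    (hW : IsCtfFactor G W) (hA : SingleCComponent G (observables W)) {Y Y' : W} {T : V}
    {t t' : Val T} (ht : Y.1.sub T = some t) (ht' : Y'.1.sub T = some t') (htt' : t ≠ t')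
    {C : Set (SCM Val)} (hC : independentInducingModels Val G ⊆ C) (Z : Set (Set V)) :
    ¬ IdentifiableFrom C Z fun M => M.ctfProb W w := by
  classical
  obtain ⟨target, htarget⟩ := hW.exists_target w
  choose alt halt using fun x (pa : ∀ j : G.Pa x, Val j) => exists_ne (target x pa)
  have hT := hW.mem_pa Y ht
  have hT' := hW.mem_pa Y' ht'
  -- For a single assignment `v`, `g` is odd at both variables or at neither; the two subscripts
  -- evaluate it at different values of `T`.
  let g : ∀ x, (∀ j : G.Pa x, Val j) → ZMod 2 := fun x pa =>
    if h : T ∈ G.Pa x then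
      if pa ⟨T, h⟩ = t ∧ (x = Y.1.var ∨ x = Y'.1.var) then 1 else 0
    else 0
  have hY : ∀ pa : ∀ j : G.Pa Y.1.var, Val j, (∀ j : G.Pa Y.1.var, Y.1.sub j = some (pa j)) →
      g Y.1.var pa = 1 := by
    intro pa hpa
    have : pa ⟨T, hT⟩ = t := Option.some_injective _ ((hpa ⟨T, hT⟩).symm.trans ht)
    simp [g, hT, this]
  have hY' : ∀ pa : ∀ j : G.Pa Y'.1.var, Val j,
      (∀ j : G.Pa Y'.1.var, Y'.1.sub j = some (pa j)) → g Y'.1.var pa = 0 := by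
    intro pa hpa
    have : pa ⟨T, hT'⟩ = t' := Option.some_injective _ ((hpa ⟨T, hT'⟩).symm.trans ht')
    simp [g, hT', this, htt'.symm]
  have hgv : ∀ (v : ∀ i, Val i) x, g x (fun j => v j) =
      if v T = t ∧ (x = Y.1.var ∨ x = Y'.1.var) then 1 else 0 := by
    intro v x
    by_cases hx : x = Y.1.var ∨ x = Y'.1.var
    · have : T ∈ G.Pa x := by rcases hx with rfl | rfl <;> assumption
      simp [g, this]
    · simp [g, hx]
  have hdata : ∀ S : Set (Sym2 V), (∃ χ, ∀ x, parityAt S x χ =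
        if x = Y.1.var ∨ x = Y'.1.var then 1 else 0) →
      ∀ (z : PartialAssignment Val) (v : ∀ i, Val i), ∃ χ, ∀ u,
      (∀ i, v i = (z i).getD (if parityAt S i u = 0 then target i (fun j => v j)
          else alt i (fun j => v j))) ↔
      (∀ i, v i = (z i).getD (if parityAt S i (u + χ) = g i (fun j => v j)
          then target i (fun j => v j) else alt i (fun j => v j))) := by
    rintro S ⟨χ, hχ⟩ z v
    refine ⟨if v T = t then χ else 0, fun u => forall_congr' fun x => ?_⟩
    have : parityAt S x (if v T = t then χ else 0) = g x (fun j => v j) := by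
      rw [hgv]
      by_cases h : v T = t
      · simp [h, hχ]
      · simp [h, parityAt_zero]
    rw [parityAt_add, this]
    simp only [add_eq_right]
  -- With a common variable, the private bit alone is read, and the factor asks it to be both 1 and
  -- 0. Otherwise the bits on the edges inside `W` are read, with a path joining the two variables.
  by_cases hne : Y.1.var = Y'.1.var
  · have hS : {s(Y.1.var, Y.1.var)} ⊆ {e : Sym2 V | e ∈ G.bi.edgeSet ∨ e.IsDiag} := by
      rintro _ rfl
      exact .inr rfl
    refine not_identifiableFrom_of_parityModel G target alt g hW htarget hS
      (hdata _ ⟨Pi.single s(Y.1.var, Y.1.var) 1, fun x => ?_⟩) (fun u hu => ?_) hC Z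
    · rw [parityAt_single, ← hne]
      simp
    · obtain ⟨pa, hpa⟩ := hW.exists_parents Y
      obtain ⟨pa', hpa'⟩ := hW.exists_parents Y'
      have h1 := hu Y pa hpa (halt _ _)
      have h0 := hu Y' pa' hpa' (halt _ _)
      rw [hY pa hpa] at h1
      rw [hY' pa' hpa', ← hne, h1] at h0
      exact one_ne_zero h0
  · refine not_identifiableFrom_of_parityModel G target alt g hW htarget
      (G.edgesWithin_subset (observables W)) (hdata _ ?_) (fun u hu => ?_) hC Z
    · have hYA : Y.1.var ∈ observables W := ⟨Y.1, Y.2, rfl⟩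
      have hYA' : Y'.1.var ∈ observables W := ⟨Y'.1, Y'.2, rfl⟩
      obtain ⟨χ, hχ⟩ := hA.exists_parityAt hYA hYA'
      refine ⟨χ, fun x => (hχ x).trans ?_⟩
      by_cases h : x = Y.1.var
      · simp [h, hne]
      · simp [h]
    · refine parityAt_edgesWithin_ne_single G (show Y.1.var ∈ observables W from ⟨Y.1, Y.2, rfl⟩) u ?_
      rintro x ⟨X, hX, rfl⟩
      by_cases h1 : X.var = Y.1.var
      · obtain ⟨pa, hpa⟩ := hW.exists_parents Y
        rw [if_pos h1, h1, hu Y pa hpa (halt _ _), hY pa hpa]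
      · rw [if_neg h1]
        by_cases h2 : X.var = Y'.1.var
        · obtain ⟨pa, hpa⟩ := hW.exists_parents Y'
          rw [h2, hu Y' pa hpa (halt _ _), hY' pa hpa]
        · obtain ⟨pa, hpa⟩ := hW.exists_parents ⟨X, hX⟩
          rw [hu ⟨X, hX⟩ pa hpa (halt _ _)]
          simp [g, h1, h2]

theorem exists_ne_ne_of_three_le_card {α : Type} (h : 3 ≤ Nat.card α) (a b : α) :
    ∃ c, c ≠ a ∧ c ≠ b := by
  by_contra! hc
  have hsub : (Set.univ : Set α) ⊆ {a, b} := by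
    intro c _
    by_cases h : c = a
    · exact .inl h
    · exact .inr (hc c h)
  have h1 := Set.ncard_le_ncard hsub (Set.toFinite _)
  have h2 := Set.ncard_insert_le a {b}
  rw [Set.ncard_univ] at h1
  rw [Set.ncard_singleton] at h2
  omega

/-- A counterfactual factor in which a subscript gives to one of its variables, which has at least
three values, a value different from the one required is not identifiable. -/
theorem IsCtfFactor.not_identifiableFrom_of_sub_var_ne [∀ i, Nontrivial (Val i)]
    (hW : IsCtfFactor G W) (hA : SingleCComponent G (observables W)) {Y X : W}
    {t : Val X.1.var} (ht : Y.1.sub X.1.var = some t) (htw : t ≠ w X)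
    (hcard : 3 ≤ Nat.card (Val X.1.var)) {C : Set (SCM Val)}
    (hC : independentInducingModels Val G ⊆ C) (Z : Set (Set V)) :
    ¬ IdentifiableFrom C Z fun M => M.ctfProb W w := by
  classical
  obtain ⟨target, htarget⟩ := hW.exists_target w
  have hk := hW.mem_pa Y ht
  have hki := G.ne_of_mem_pa hk
  have hiA : Y.1.var ∈ observables W := ⟨Y.1, Y.2, rfl⟩
  have hkA : X.1.var ∈ observables W := ⟨X.1, X.2, rfl⟩
  -- At `X`, the value `t` occurs without intervention only if `target` is `t`, and then regardless
  -- of parity; avoiding both `t` and `target` otherwise takes a third value. At the child, the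
  -- parity matters only if `X = t`.
  have halt : ∀ x (pa : ∀ j : G.Pa x, Val j), ∃ a : Val x,
      (∀ h : x = X.1.var, (target x pa = h ▸ t → a = target x pa) ∧
        (target x pa ≠ h ▸ t → a ≠ h ▸ t ∧ a ≠ target x pa)) ∧
      (x = Y.1.var → ∀ h : X.1.var ∈ G.Pa x, (pa ⟨X.1.var, h⟩ ≠ t → a = target x pa) ∧
        (pa ⟨X.1.var, h⟩ = t → a ≠ target x pa)) ∧
      (x ≠ X.1.var → x ≠ Y.1.var → a ≠ target x pa) := by
    intro x pa
    by_cases h1 : x = X.1.var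
    · subst h1
      by_cases h2 : target X.1.var pa = t
      · exact ⟨target X.1.var pa, fun _ => ⟨fun _ => rfl, fun h => (h h2).elim⟩,
          fun h => (hki h).elim, fun h => (h rfl).elim⟩
      · obtain ⟨c, hc⟩ := exists_ne_ne_of_three_le_card hcard t (target X.1.var pa)
        exact ⟨c, fun _ => ⟨fun h => (h2 h).elim, fun _ => hc⟩,
          fun h => (hki h).elim, fun h => (h rfl).elim⟩
    · obtain ⟨c, hc⟩ := exists_ne (target x pa)
      by_cases h3 : ∃ h : X.1.var ∈ G.Pa x, x = Y.1.var ∧ pa ⟨X.1.var, h⟩ ≠ t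
      · obtain ⟨h, h4, h5⟩ := h3
        exact ⟨target x pa, fun h => (h1 h).elim, fun _ _ => ⟨fun _ => rfl, fun h => (h5 h).elim⟩,
          fun _ h => (h h4).elim⟩
      · exact ⟨c, fun h => (h1 h).elim,
          fun h4 h => ⟨fun h5 => (h3 ⟨h, h4, h5⟩).elim, fun _ => hc⟩, fun _ _ => hc⟩
  choose alt halt using halt
  refine not_identifiableFrom_of_parityModel G target alt (fun x _ => if x = Y.1.var then 1 else 0)
    hW htarget (G.edgesWithin_subset (observables W)) (fun z v => ?_) (fun u hu => ?_) hC Z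
  · by_cases hvk : v X.1.var = t
    · obtain ⟨χ, hχ⟩ := hA.exists_parityAt hiA hkA
      refine ⟨χ, fun u => ?_⟩
      -- Here `X` is not intervened on and neither `target` nor `alt` is `t`, so `v` is impossible
      -- in both models.
      by_cases hz : z X.1.var = none ∧ target X.1.var (fun j => v j) ≠ t
      · have hne := ((halt X.1.var fun j => v j).1 rfl).2 hz.2
        refine iff_of_false (fun h => ?_) fun h => ?_
        all_goals
          have hkk := h X.1.var
          rw [hz.1, Option.getD_none, hvk] at hkk
          exact (ite_eq_or_eq ..).elim (fun h => hz.2 (h.symm.trans hkk.symm))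
            fun h => hne.1 (h.symm.trans hkk.symm)
      · refine forall_congr' fun x => ?_
        by_cases hx : x = X.1.var
        · subst hx
          -- Either `target` and `alt` are both `t`, or `X` is fixed by intervention; its parity has
          -- no effect.
          rcases hzx : z X.1.var with _ | a
          · have htx : target X.1.var (fun j => v j) = t := by
              by_contra h
              exact hz ⟨hzx, h⟩
            have := ((halt _ fun j => v j).1 rfl).1 htx
            simp [this]
          · simp
        · rw [parityAt_add, hχ, if_neg hx, add_zero]
          simp only [add_eq_right]
    -- With `X ≠ t`, the child ignores its parity, the only one on which `g` differs from 0.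
    · refine ⟨0, fun u => forall_congr' fun x => ?_⟩
      rw [add_zero]
      by_cases hx : x = Y.1.var
      · have := ((halt x fun j => v j).2.1 hx (hx ▸ hk)).1 hvk
        simp [this]
      · simp [hx]
  · refine parityAt_edgesWithin_ne_single G hiA u ?_
    rintro x ⟨X', hX', rfl⟩
    by_cases h1 : X'.var = Y.1.var
    · obtain ⟨pa, hpa⟩ := hW.exists_parents Y
      have hpak : pa ⟨X.1.var, hk⟩ = t := Option.some_injective _ ((hpa ⟨X.1.var, hk⟩).symm.trans ht)
      rw [h1]
      exact hu Y pa hpa (((halt _ pa).2.1 rfl hk).2 hpak)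
    · by_cases h2 : X'.var = X.1.var
      · obtain ⟨pa, hpa⟩ := hW.exists_parents X
        rw [h2]
        -- The factor requires a value of `X` other than `t`, so there `alt` differs from `target`
        -- and the parity at `X` is forced to be even.
        refine hu X pa hpa (((halt _ pa).1 rfl).2 ?_).2
        rw [htarget X pa hpa]
        exact htw.symm
      · obtain ⟨pa, hpa⟩ := hW.exists_parents ⟨X', hX'⟩
        exact hu ⟨X', hX'⟩ pa hpa ((halt _ pa).2.2 h2 h1)

end Conflict

/-! ### Assembly of the theorem -/

theorem mainTheorem3 {V : Type} [Finite V] {Val : V → Type} [∀ i, Finite (Val i)]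
    [∀ i, Nontrivial (Val i)] (G : CausalDiagram V) (W : Set (CtfVar Val))
    (w : ∀ Y : W, Val Y.1.var) (hW : IsCtfFactor G W) :
    (¬ HasConflict W w →
      (∃ v, AgreesWith W w v) ∧
      ∀ v, AgreesWith W w v → ∀ M : SCM Val, M.diagram = G →
        M.ctfProb W w =
          M.interventionalProb (restrictTo v (observables W)ᶜ) (observables W) v) ∧
    (SingleCComponent G (observables W) →
      (∀ X ∈ observables W, (∃ Y ∈ observables W, X ∈ G.Pa Y) → 3 ≤ Nat.card (Val X)) →
      ∀ C : Set (SCM Val), C = inducingModels Val G ∨ C = independentInducingModels Val G →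
        ∀ Z : Set (Set V),
          (IdentifiableFrom C Z (fun M => M.ctfProb W w) ↔
            ¬ IsInconsistent G W w ∧
            ∃ v, AgreesWith W w v ∧
              IdentifiableFrom C Z (fun M =>
                M.interventionalProb (restrictTo v (observables W)ᶜ) (observables W) v)) ∧
          ((observables W)ᶜ ∈ Z →
            (IdentifiableFrom C Z (fun M => M.ctfProb W w) ↔ ¬ IsInconsistent G W w))) := by
  refine ⟨fun hc => ⟨exists_agreesWith hW hc, fun v hv M hM =>
    ctfProb_eq_interventionalProb hW hv M hM⟩, fun hA hcard C hC Z => ?_⟩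
  -- Only two inclusions matter for the class: its models induce `G`, so the equality of the first
  -- part applies, and it contains the independent models, hence the parity models.
  have hCsub : C ⊆ inducingModels Val G := by
    rcases hC with rfl | rfl
    · exact subset_rfl
    · exact fun M hM => hM.1
  have hsubC : independentInducingModels Val G ⊆ C := by
    rcases hC with rfl | rfl
    · exact fun M hM => hM.1
    · exact subset_rfl
  have hiff : ∀ v, AgreesWith W w v → (IdentifiableFrom C Z (fun M => M.ctfProb W w) ↔
      IdentifiableFrom C Z (fun M =>
        M.interventionalProb (restrictTo v (observables W)ᶜ) (observables W) v)) := by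
    intro v hv
    refine forall₂_congr fun M hM => forall₃_congr fun N hN _ => ?_
    simp only [ctfProb_eq_interventionalProb hW hv M (hCsub hM),
      ctfProb_eq_interventionalProb hW hv N (hCsub hN)]
  have hnot : HasConflict W w → ¬ IdentifiableFrom C Z (fun M => M.ctfProb W w) := by
    rintro (⟨Y, X, t, ht, htw⟩ | ⟨Y, Y', T, t, t', ht, ht', htt'⟩)
    · exact hW.not_identifiableFrom_of_sub_var_ne hA ht htw
        (hcard _ ⟨X.1, X.2, rfl⟩ ⟨_, ⟨Y.1, Y.2, rfl⟩, hW.mem_pa Y ht⟩) hsubC Z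
    · exact hW.not_identifiableFrom_of_sub_ne hA ht ht' htt' hsubC Z
  have hcon : ¬ IsInconsistent G W w → ∃ v, AgreesWith W w v := fun h =>
    exists_agreesWith hW fun hc => h ⟨hW, hA, hc⟩
  refine ⟨⟨fun h => ?_, fun ⟨_, v, hv, hid⟩ => (hiff v hv).2 hid⟩, fun hZ => ⟨fun h hinc =>
    hnot hinc.2.2 h, fun h => ?_⟩⟩
  · have hinc : ¬ IsInconsistent G W w := fun hinc => hnot hinc.2.2 h
    obtain ⟨v, hv⟩ := hcon hinc
    exact ⟨hinc, v, hv, (hiff v hv).1 h⟩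
  · obtain ⟨v, hv⟩ := hcon h
    refine (hiff v hv).2 fun M _ N _ hMN => hMN.interventionalProb_eq ?_ _ v
    rw [dom_restrictTo]
    exact hZ
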